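/- A Banach sequence space is a linear space $X\subset\mathbb R^{\mathbb N}$ with a complete norm such that $|f|\le|g|$ pointwise and $g\in X$ imply $f\in X$ and $\|f\|_X\le\|g\|_X$. A sequence space $E$ is saturated if there is no nonempty $A\subset\mathbb N$ such that every $f\in E$ vanishes on $A$. For sequence spaces $X,Y$ put $X^Y=\{h\in\mathbb R^{\mathbb N}: fh\in Y\text{ for all }f\in X\}$; for $h\in X^Y$ let $M_h\colon X\to Y$, $M_h(f)=fh$. For saturated $X$, $X'=X^{\ell^1}$ with norm $\|h\|_{X'}=\sup_{\|f\|_X\le1}\sum_k|f_kh_k|$, and $X''=(X')'$. $X$ is $\sigma$-order continuous if $\|f_n\|_X\to0$ whenever $f_n\in X$ decreases pointwise to $0$. For $v\in\mathbb R^{\mathbb N}$, $$\|v\|_{X\pi Y}=\inf\Big\{\sum_n\|f_n\|_X\|g_n\|_Y\Big\},$$ the infimum being over all sequences $(f_n)\subset X$, $(g_n)\subset Y$ with $|v|\le\sum_n|f_ng_n|$ pointwise and $\sum_n\|f_n\|_X\|g_n\|_Y<\infty$; $X\pi Y$ is the space of those $v$ for which such sequences exist. Let $(e^n)$ denote the unit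 vectors. **Proposition.** Let $X_1,X_2,Y_1,Y_2$ be saturated Banach sequence spaces such that $(e^n)$ is a Schauder basis of each of $X_1,X_2,Y_1,Y_2$ and of $Y_1'$. Let $T\colon X_1\to Y_1$ and $S\colon X_2\to Y_2$ be nonzero continuous linear operators with matrices $a_{ij}=T(e^j)_i$ and $b_{ij}=S(e^j)_i$. Assume that $Y_2^{Y_1''}$ is saturated and that $Y_2$ or $Y_1'$ is $\sigma$-order continuous. Given $h\in X_1^{X_2}$, the following are equivalent: (a) $T$ factors strongly through $S$ and $M_h$, that is, there is $g\in Y_2^{Y_1''}$ such that $T(x)=M_g(S(M_h(x)))$ (an equality in $Y_1''$) for all $x\in X_1$. (b) There is $g\in Y_2^{Y_1''}$ such that $\frac{a_{ij}}{b_{ij}}=g_ih_j$ whenever $b_{ij}\ne0$, and $a_{ij}=0$ whenever $b_{ij}=0$. (c) There is a constant $C>0$ such that for all $n,m\in\mathbb N$ and all real $(r_{ij})$ with $|r_{ij}|\le1$, $$\sum_{i=1}^n\sum_{j=1}^mr_{ij}a_{ij}\le C\,\Big\|\sum_{i=1}^n\Big(\sum_{j=1}^mh_jr_{ij}b_{ij}\Big)e^i\Big\|_{Y_2\pi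 Y_1'}.$$ Moreover, if $Y_2\subset Y_1''$, then the condition (d) there is a constant $C>0$ such that for all $n,m\in\mathbb N$ and all real $(r_j)$ with $|r_j|\le1$, $$\sum_{j=1}^mr_ja_{nj}\le C\,\Big|\sum_{j=1}^mh_jr_jb_{nj}\Big|,$$ implies (a)–(c). If $\ell^\infty=Y_2^{Y_1''}$ (as sets), then (d) is equivalent to (a)–(c). -/

import Mathlib

open Filter Topology

/-- A Banach sequence space, i.e. a Banach function space over `ℕ` with the counting measure: a
linear space of real sequences with a complete norm such that `|f| ≤ |g|` pointwise and `g` in the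
space imply that `f` is in the space and `‖f‖ ≤ ‖g‖`.  (The only null set of the counting measure
is empty, so sequences are not identified with each other.) -/
structure BanachSeqSpace where
  /-- the underlying linear space of real sequences -/
  carrier : Submodule ℝ (ℕ → ℝ)
  /-- the norm -/
  nrm : Seminorm ℝ carrier
  eq_zero_of_nrm : ∀ x : carrier, nrm x = 0 → x = 0
  solid : ∀ (f : ℕ → ℝ) (g : carrier), (∀ k, |f k| ≤ |(g : ℕ → ℝ) k|) →
    ∃ hf : f ∈ carrier, nrm ⟨f, hf⟩ ≤ nrm g
  complete : ∀ u : ℕ → carrier,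
    (∀ ε > 0, ∃ N, ∀ m ≥ N, ∀ n ≥ N, nrm (u m - u n) < ε) →
    ∃ x : carrier, Tendsto (fun n => nrm (u n - x)) atTop (𝓝 0)

namespace BanachSeqSpace

/-- The type of elements of `X`.  It is a separate type so that it carries the topology of the norm
and not the topology of coordinatewise convergence. -/
def Elem (X : BanachSeqSpace) : Type := X.carrier

instance : CoeSort BanachSeqSpace Type := ⟨Elem⟩

/-- The sequence underlying an element of `X`. -/
def Elem.seq {X : BanachSeqSpace} (x : X) : ℕ → ℝ := (show X.carrier from x).1

/-- An element of `X` from a sequence that lies in `X`. -/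
def ofSeq (X : BanachSeqSpace) (f : ℕ → ℝ) (hf : f ∈ X.carrier) : X := (⟨f, hf⟩ : X.carrier)

instance (X : BanachSeqSpace) : AddCommGroup X := inferInstanceAs (AddCommGroup X.carrier)

instance (X : BanachSeqSpace) : Module ℝ X := inferInstanceAs (Module ℝ X.carrier)

instance (X : BanachSeqSpace) : Norm X := ⟨fun x => X.nrm x⟩

theorem normCore (X : BanachSeqSpace) : NormedSpace.Core ℝ X where
  norm_nonneg x := apply_nonneg X.nrm x
  norm_smul c x := map_smul_eq_mul X.nrm c x
  norm_triangle x y := map_add_le_add X.nrm x y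
  norm_eq_zero_iff x := ⟨fun h => X.eq_zero_of_nrm x h, fun h => by subst h; exact map_zero X.nrm⟩

noncomputable instance (X : BanachSeqSpace) : NormedAddCommGroup X := NormedAddCommGroup.ofCore X.normCore

noncomputable instance (X : BanachSeqSpace) : NormedSpace ℝ X := NormedSpace.ofCore X.normCore

instance (X : BanachSeqSpace) : CompleteSpace X := by
  refine Metric.complete_of_cauchySeq_tendsto fun u hu => ?_
  obtain ⟨x, hx⟩ := X.complete u fun ε hε => by
    obtain ⟨N, hN⟩ := Metric.cauchySeq_iff.1 hu ε hε
    refine ⟨N, fun m hm n hn => ?_⟩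
    have := hN m hm n hn
    rwa [dist_eq_norm] at this
  exact ⟨x, tendsto_iff_norm_sub_tendsto_zero.2 hx⟩

section basic

variable {X : BanachSeqSpace}

theorem seq_mem (x : X) : x.seq ∈ X.carrier := (show X.carrier from x).2

theorem seq_ofSeq (f : ℕ → ℝ) (hf : f ∈ X.carrier) : (X.ofSeq f hf).seq = f := rfl

theorem seq_injective {x y : X} (h : x.seq = y.seq) : x = y := Subtype.ext h

theorem seq_add (x y : X) : (x + y).seq = x.seq + y.seq := rfl

theorem seq_sub (x y : X) : (x - y).seq = x.seq - y.seq := rfl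

theorem seq_smul (c : ℝ) (x : X) : (c • x).seq = c • x.seq := rfl

theorem norm_le_of_abs_le {f : ℕ → ℝ} {g : X} (h : ∀ k, |f k| ≤ |g.seq k|) :
    ∃ hf : f ∈ X.carrier, ‖X.ofSeq f hf‖ ≤ ‖g‖ := X.solid f g h

end basic

/-- The sequence space `E` is saturated: there is no nonempty set of indices on which all sequences
of `E` vanish. -/
def Saturated (E : Submodule ℝ (ℕ → ℝ)) : Prop :=
  ∀ A : Set ℕ, A.Nonempty → ∃ f ∈ E, A.indicator f ≠ 0

theorem single_mem {X : BanachSeqSpace} (hX : Saturated X.carrier) (n : ℕ) :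
    (Pi.single n 1 : ℕ → ℝ) ∈ X.carrier := by
  obtain ⟨f, hf, hn⟩ := hX {n} ⟨n, rfl⟩
  have hfn : f n ≠ 0 := by
    intro h0
    apply hn
    funext k
    by_cases hk : k = n
    · subst hk; simp [h0]
    · simp [hk]
  have h1 : (Pi.single n (f n) : ℕ → ℝ) ∈ X.carrier := by
    obtain ⟨h, -⟩ := norm_le_of_abs_le (X := X) (f := Pi.single n (f n)) (g := X.ofSeq f hf)
      (fun k => by
        rw [seq_ofSeq]
        by_cases hk : k = n
        · subst hk; simp
        · simp [hk])
    exact h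
  have h2 := X.carrier.smul_mem (f n)⁻¹ h1
  have h3 : (f n)⁻¹ • (Pi.single n (f n) : ℕ → ℝ) = Pi.single n 1 := by
    funext k
    by_cases hk : k = n
    · subst hk; simp [hfn]
    · simp [hk]
  rwa [h3] at h2

/-- The unit vector `eⁿ` as an element of the saturated space `X`. -/
def unit (X : BanachSeqSpace) (hX : Saturated X.carrier) (n : ℕ) : X :=
  X.ofSeq (Pi.single n 1) (single_mem hX n)

/-- The unit vectors form a Schauder basis of `X`. -/
def HasUnitBasis (X : BanachSeqSpace) (hX : Saturated X.carrier) : Prop :=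
  ∃ b : SchauderBasis ℝ X, ∀ n, b.basis n = X.unit hX n

/-- `X` is σ-order continuous: if `fₙ ∈ X` decreases pointwise to `0`, then `‖fₙ‖ → 0`. -/
def SigmaOrderContinuous (X : BanachSeqSpace) : Prop :=
  ∀ f : ℕ → X, (∀ k, Antitone fun n => (f n).seq k) →
    (∀ k, Tendsto (fun n => (f n).seq k) atTop (𝓝 0)) → Tendsto (fun n => ‖f n‖) atTop (𝓝 0)

/-- The `F`-dual `E^F = {h : f h ∈ F for all f ∈ E}` of `E`. -/
def mulDual (E F : Submodule ℝ (ℕ → ℝ)) : Submodule ℝ (ℕ → ℝ) where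
  carrier := {h | ∀ f ∈ E, f * h ∈ F}
  add_mem' := fun ha hb f hf => by rw [mul_add]; exact F.add_mem (ha f hf) (hb f hf)
  zero_mem' := fun f _ => by rw [mul_zero]; exact F.zero_mem
  smul_mem' := fun c _ ha f hf => by rw [mul_smul_comm]; exact F.smul_mem c (ha f hf)

/-- The multiplication operator `M_h : X → Y`, `f ↦ f h`, for `h ∈ X^Y`. -/
noncomputable def mulOp {X Y : BanachSeqSpace} {h : ℕ → ℝ} (hh : h ∈ mulDual X.carrier Y.carrier) :
    X →ₗ[ℝ] Y where
  toFun x := Y.ofSeq (x.seq * h) (hh x.seq (seq_mem x))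
  map_add' x y := seq_injective (add_mul x.seq y.seq h)
  map_smul' c x := seq_injective (smul_mul_assoc c x.seq h)

/-- The linear space `ℓ¹`. -/
def ellOne : Submodule ℝ (ℕ → ℝ) where
  carrier := {f | Summable f}
  add_mem' := fun ha hb => ha.add hb
  zero_mem' := summable_zero
  smul_mem' := fun c _ ha => ha.const_smul c

/-- The linear space `ℓ^∞`. -/
def ellInfty : Submodule ℝ (ℕ → ℝ) where
  carrier := {f | ∃ C, ∀ k, |f k| ≤ C}
  add_mem' := by
    rintro f g ⟨C, hC⟩ ⟨D, hD⟩
    exact ⟨C + D, fun k => (abs_add_le _ _).trans (add_le_add (hC k) (hD k))⟩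
  zero_mem' := ⟨0, fun k => by simp⟩
  smul_mem' := by
    rintro c f ⟨C, hC⟩
    refine ⟨|c| * C, fun k => ?_⟩
    rw [Pi.smul_apply, smul_eq_mul, abs_mul]
    exact mul_le_mul_of_nonneg_left (hC k) (abs_nonneg c)

section koethe

variable {X : BanachSeqSpace}

/-- Each coordinate is a continuous functional. -/
theorem exists_coord (X : BanachSeqSpace) (k : ℕ) : ∃ φ : X →L[ℝ] ℝ, ∀ x : X, φ x = x.seq k := by
  let L : X →ₗ[ℝ] ℝ :=
    { toFun := fun x => x.seq k, map_add' := fun x y => rfl, map_smul' := fun c x => rfl }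
  have key : ∃ C : ℝ, ∀ x : X, |x.seq k| ≤ C * ‖x‖ := by
    by_cases h : ∃ x : X, x.seq k ≠ 0
    · obtain ⟨y, hy⟩ := h
      have hs : ∀ x : X, ∃ hf : (Pi.single k (x.seq k) : ℕ → ℝ) ∈ X.carrier,
          ‖X.ofSeq _ hf‖ ≤ ‖x‖ := fun x => norm_le_of_abs_le (fun j => by
        by_cases hj : j = k
        · subst hj; simp
        · simp [hj])
      obtain ⟨hy1, -⟩ := hs y
      set e := X.ofSeq _ hy1 with he
      have he0 : 0 < ‖e‖ := by
        rw [norm_pos_iff]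
        intro h0
        have h1 : e.seq k = (0 : X).seq k := by rw [h0]
        apply hy
        have h2 : e.seq k = y.seq k := by rw [he, seq_ofSeq]; simp
        rw [← h2, h1]
        rfl
      refine ⟨|y.seq k| / ‖e‖, fun x => ?_⟩
      obtain ⟨hx1, hx2⟩ := hs x
      have hxe : X.ofSeq _ hx1 = (x.seq k / y.seq k) • e := by
        apply seq_injective
        rw [seq_smul, he, seq_ofSeq, seq_ofSeq]
        funext j
        by_cases hj : j = k
        · subst hj; simp [hy]
        · simp [hj]
      rw [hxe, norm_smul, Real.norm_eq_abs, abs_div] at hx2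
      have hy0 : 0 < |y.seq k| := abs_pos.2 hy
      rw [div_mul_eq_mul_div, div_le_iff₀ hy0] at hx2
      rw [div_mul_eq_mul_div, le_div_iff₀ he0]
      linarith
    · push Not at h
      exact ⟨0, fun x => by simp [h x]⟩
  obtain ⟨C, hC⟩ := key
  exact ⟨L.mkContinuous C hC, fun x => rfl⟩

theorem mem_mulDual_ellOne {h : ℕ → ℝ} :
    h ∈ mulDual X.carrier ellOne ↔ ∀ x : X, Summable fun k => |x.seq k * h k| :=
  ⟨fun hh x => (hh x.seq (seq_mem x)).abs, fun hh f hf => (hh (X.ofSeq f hf)).of_abs⟩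

/-- A Köthe dual sequence acts boundedly. -/
theorem exists_bound {h : ℕ → ℝ} (hh : h ∈ mulDual X.carrier ellOne) :
    ∃ C : ℝ, ∀ x : X, ‖x‖ ≤ 1 → ∑' k, |x.seq k * h k| ≤ C := by
  choose φ hφ using X.exists_coord
  obtain ⟨C, hC⟩ := banach_steinhaus (g := fun N : ℕ => ∑ k ∈ Finset.range N, |h k| • φ k)
    (fun x => ⟨∑' k, |x.seq k * h k|, fun N => by
      have h1 : (∑ k ∈ Finset.range N, |h k| • φ k) x
          = ∑ k ∈ Finset.range N, |h k| * x.seq k := by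
        simp [sum_apply, hφ]
      rw [h1, Real.norm_eq_abs]
      refine (Finset.abs_sum_le_sum_abs _ _).trans ?_
      have h2 : ∀ k ∈ Finset.range N, abs (|h k| * x.seq k) = |x.seq k * h k| := fun k _ => by
        rw [abs_mul, abs_abs, abs_mul, mul_comm]
      rw [Finset.sum_congr rfl h2]
      exact (mem_mulDual_ellOne.1 hh x).sum_le_tsum _ (fun _ _ => abs_nonneg _)⟩)
  refine ⟨C, fun x hx => ?_⟩
  obtain ⟨hm, hle⟩ := norm_le_of_abs_le (X := X) (f := fun k => |x.seq k|) (g := x)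
    (fun k => by simp)
  refine (mem_mulDual_ellOne.1 hh x).tsum_le_of_sum_range_le fun N => ?_
  have h1 : (∑ k ∈ Finset.range N, |h k| • φ k) (X.ofSeq _ hm)
      = ∑ k ∈ Finset.range N, |x.seq k * h k| := by
    simp only [sum_apply, smul_apply, hφ, seq_ofSeq,
      smul_eq_mul, abs_mul]
    exact Finset.sum_congr rfl fun k _ => mul_comm _ _
  rw [← h1]
  have h0 : 0 ≤ C := (norm_nonneg _).trans (hC 0)
  calc _ ≤ ‖(∑ k ∈ Finset.range N, |h k| • φ k) (X.ofSeq _ hm)‖ := Real.le_norm_self _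
    _ ≤ C * ‖X.ofSeq _ hm‖ := ContinuousLinearMap.le_of_opNorm_le _ (hC N) _
    _ ≤ C * 1 := mul_le_mul_of_nonneg_left (hle.trans hx) h0
    _ = C := mul_one C

/-- The norm `sup {∑ₖ |fₖ hₖ| : f ∈ B_X}` of the Köthe dual. -/
noncomputable def koetheNorm (X : BanachSeqSpace) (h : ℕ → ℝ) : ℝ :=
  sSup {s | ∃ x : X, ‖x‖ ≤ 1 ∧ s = ∑' k, |x.seq k * h k|}

theorem le_koetheNorm {h : ℕ → ℝ} (hh : h ∈ mulDual X.carrier ellOne) {x : X} (hx : ‖x‖ ≤ 1) :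
    ∑' k, |x.seq k * h k| ≤ X.koetheNorm h := by
  obtain ⟨C, hC⟩ := exists_bound hh
  refine le_csSup ⟨C, ?_⟩ ⟨x, hx, rfl⟩
  rintro s ⟨y, hy, rfl⟩
  exact hC y hy

theorem koetheNorm_le {h : ℕ → ℝ} {C : ℝ}
    (hC : ∀ x : X, ‖x‖ ≤ 1 → ∑' k, |x.seq k * h k| ≤ C) : X.koetheNorm h ≤ C := by
  refine csSup_le ⟨_, 0, by simp, rfl⟩ ?_
  rintro s ⟨y, hy, rfl⟩
  exact hC y hy

theorem koetheNorm_add {g h : ℕ → ℝ} (hg : g ∈ mulDual X.carrier ellOne)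
    (hh : h ∈ mulDual X.carrier ellOne) :
    X.koetheNorm (g + h) ≤ X.koetheNorm g + X.koetheNorm h := by
  refine koetheNorm_le fun x hx => ?_
  have h1 := mem_mulDual_ellOne.1 hg x
  have h2 := mem_mulDual_ellOne.1 hh x
  have h3 := mem_mulDual_ellOne.1 ((mulDual X.carrier ellOne).add_mem hg hh) x
  calc _ ≤ ∑' k, (|x.seq k * g k| + |x.seq k * h k|) :=
        h3.tsum_le_tsum (fun k => by rw [Pi.add_apply, mul_add]; exact abs_add_le _ _) (h1.add h2)
    _ = _ := h1.tsum_add h2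
    _ ≤ _ := add_le_add (le_koetheNorm hg hx) (le_koetheNorm hh hx)

theorem koetheNorm_smul_le {h : ℕ → ℝ} (c : ℝ) (hh : h ∈ mulDual X.carrier ellOne) :
    X.koetheNorm (c • h) ≤ |c| * X.koetheNorm h := by
  refine koetheNorm_le fun x hx => ?_
  have h1 : ∀ k, |x.seq k * (c • h) k| = |c| * |x.seq k * h k| := fun k => by
    rw [Pi.smul_apply, smul_eq_mul, ← abs_mul]; ring_nf
  simp only [h1, tsum_mul_left]
  exact mul_le_mul_of_nonneg_left (le_koetheNorm hh hx) (abs_nonneg c)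

/-- Coordinates are controlled by the norm of the Köthe dual. -/
theorem abs_le_koetheNorm (hX : Saturated X.carrier) (k : ℕ) :
    ∃ C : ℝ, ∀ h ∈ mulDual X.carrier ellOne, |h k| ≤ C * X.koetheNorm h := by
  have hu : X.unit hX k ≠ 0 := by
    intro h0
    have h1 : (X.unit hX k).seq k = (0 : X).seq k := by rw [h0]
    have h2 : (X.unit hX k).seq k = 1 := by simp [unit, seq_ofSeq]
    rw [h2] at h1
    exact one_ne_zero h1
  have hp : 0 < ‖X.unit hX k‖ := norm_pos_iff.2 hu
  refine ⟨‖X.unit hX k‖, fun h hh => ?_⟩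
  have h1 := le_koetheNorm hh (x := ‖X.unit hX k‖⁻¹ • X.unit hX k)
    (by rw [norm_smul, norm_inv, norm_norm, inv_mul_cancel₀ hp.ne'])
  have h2 := (mem_mulDual_ellOne.1 hh (‖X.unit hX k‖⁻¹ • X.unit hX k)).le_tsum k
    (fun _ _ => abs_nonneg _)
  have h3 : (‖X.unit hX k‖⁻¹ • X.unit hX k).seq k = ‖X.unit hX k‖⁻¹ := by
    rw [seq_smul]; simp [unit, seq_ofSeq]
  rw [h3, abs_mul, abs_of_pos (inv_pos.2 hp)] at h2
  have h4 := h2.trans h1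
  rwa [inv_mul_le_iff₀ hp] at h4

/-- The Köthe dual `X' = X^{ℓ¹}` of a saturated Banach sequence space, with the norm
`‖h‖ = sup {∑ₖ |fₖ hₖ| : f ∈ B_X}`. -/
noncomputable def koetheDual (X : BanachSeqSpace) (hX : Saturated X.carrier) : BanachSeqSpace where
  carrier := mulDual X.carrier ellOne
  nrm := Seminorm.ofSMulLE (fun h => X.koetheNorm h)
    (le_antisymm (koetheNorm_le fun x _ => by simp)
      ((tsum_nonneg fun _ => abs_nonneg _).trans
        (le_koetheNorm (Submodule.zero_mem _) (x := (0 : X)) (by simp))))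
    (fun g h => koetheNorm_add g.2 h.2)
    (fun c h => koetheNorm_smul_le c h.2)
  eq_zero_of_nrm := fun h h0 => by
    apply Subtype.ext
    funext k
    obtain ⟨C, hC⟩ := abs_le_koetheNorm hX k
    have h1 := hC h.1 h.2
    have h2 : X.koetheNorm h.1 = 0 := h0
    rw [h2, mul_zero] at h1
    exact abs_nonpos_iff.1 h1
  solid := fun f g hfg => by
    have hle : ∀ (x : X) k, |x.seq k * f k| ≤ |x.seq k * g.1 k| := fun x k => by
      rw [abs_mul, abs_mul]
      exact mul_le_mul_of_nonneg_left (hfg k) (abs_nonneg _)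
    have hf : ∀ x : X, Summable fun k => |x.seq k * f k| := fun x =>
      (mem_mulDual_ellOne.1 g.2 x).of_nonneg_of_le (fun _ => abs_nonneg _) (hle x)
    refine ⟨mem_mulDual_ellOne.2 hf, koetheNorm_le fun x hx => ?_⟩
    exact ((hf x).tsum_le_tsum (hle x) (mem_mulDual_ellOne.1 g.2 x)).trans (le_koetheNorm g.2 hx)
  complete := fun u hu => by
    change ∀ ε > 0, ∃ N, ∀ m ≥ N, ∀ n ≥ N, X.koetheNorm ((u m).1 - (u n).1) < ε at hu
    have hlim : ∀ k, ∃ l, Tendsto (fun n => (u n).1 k) atTop (𝓝 l) := fun k => by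
      obtain ⟨C, hC⟩ := abs_le_koetheNorm hX k
      refine cauchySeq_tendsto_of_complete (Metric.cauchySeq_iff.2 fun ε hε => ?_)
      have hD : 0 < |C| + 1 := by positivity
      obtain ⟨N, hN⟩ := hu (ε / (|C| + 1)) (div_pos hε hD)
      refine ⟨N, fun m hm n hn => ?_⟩
      have h0 := hN m hm n hn
      have h1 := hC _ (Submodule.sub_mem _ (u m).2 (u n).2)
      rw [Real.dist_eq]
      have hpos : 0 ≤ X.koetheNorm ((u m).1 - (u n).1) :=
        (tsum_nonneg fun _ => abs_nonneg _).trans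
          (le_koetheNorm (Submodule.sub_mem _ (u m).2 (u n).2) (x := (0 : X)) (by simp))
      calc _ ≤ C * X.koetheNorm ((u m).1 - (u n).1) := h1
        _ ≤ (|C| + 1) * X.koetheNorm ((u m).1 - (u n).1) :=
          mul_le_mul_of_nonneg_right ((le_abs_self C).trans (by linarith)) hpos
        _ < (|C| + 1) * (ε / (|C| + 1)) := mul_lt_mul_of_pos_left h0 hD
        _ = ε := mul_div_cancel₀ _ hD.ne'
    choose l hl using hlim
    have hfin : ∀ ε > 0, ∃ N, ∀ n ≥ N, ∀ x : X, ‖x‖ ≤ 1 → ∀ M,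
        ∑ k ∈ Finset.range M, |x.seq k * ((u n).1 k - l k)| ≤ ε := fun ε hε => by
      obtain ⟨N, hN⟩ := hu ε hε
      refine ⟨N, fun n hn x hx M => ?_⟩
      have ht : Tendsto (fun m => ∑ k ∈ Finset.range M, |x.seq k * ((u n).1 k - (u m).1 k)|) atTop
          (𝓝 (∑ k ∈ Finset.range M, |x.seq k * ((u n).1 k - l k)|)) :=
        tendsto_finsetSum _ fun k _ => ((tendsto_const_nhds.sub (hl k)).const_mul _).abs
      refine le_of_tendsto ht ?_
      filter_upwards [eventually_ge_atTop N] with m hm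
      have hmem := Submodule.sub_mem _ (u n).2 (u m).2
      exact ((mem_mulDual_ellOne.1 hmem x).sum_le_tsum _ (fun _ _ => abs_nonneg _)).trans
        ((le_koetheNorm hmem hx).trans (hN n hn m hm).le)
    have hdiff : ∃ n, (u n).1 - l ∈ mulDual X.carrier ellOne := by
      obtain ⟨N, hN⟩ := hfin 1 one_pos
      refine ⟨N, mem_mulDual_ellOne.2 fun x => ?_⟩
      have hs : ∀ y : X, ‖y‖ ≤ 1 → Summable fun k => |y.seq k * ((u N).1 - l) k| := fun y hy =>
        summable_of_sum_range_le (fun _ => abs_nonneg _) (hN N le_rfl y hy)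
      by_cases hx : x = 0
      · exact hs x (by simp [hx])
      · have hp : 0 < ‖x‖ := norm_pos_iff.2 hx
        have h1 := (hs (‖x‖⁻¹ • x)
          (by rw [norm_smul, norm_inv, norm_norm, inv_mul_cancel₀ hp.ne'])).mul_left ‖x‖
        refine h1.congr fun k => ?_
        rw [seq_smul, Pi.smul_apply, smul_eq_mul, mul_assoc, abs_mul, abs_of_pos (inv_pos.2 hp),
          mul_inv_cancel_left₀ hp.ne']
    have hlmem : l ∈ mulDual X.carrier ellOne := by
      obtain ⟨n, hn⟩ := hdiff
      have := Submodule.sub_mem _ (u n).2 hn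
      rwa [sub_sub_cancel] at this
    refine ⟨⟨l, hlmem⟩, ?_⟩
    change Tendsto (fun n => X.koetheNorm ((u n).1 - l)) atTop (𝓝 0)
    rw [Metric.tendsto_atTop]
    intro ε hε
    obtain ⟨N, hN⟩ := hfin (ε / 2) (half_pos hε)
    refine ⟨N, fun n hn => ?_⟩
    have hmem := Submodule.sub_mem _ (u n).2 hlmem
    have hpos : 0 ≤ X.koetheNorm ((u n).1 - l) :=
      (tsum_nonneg fun _ => abs_nonneg _).trans (le_koetheNorm hmem (x := (0 : X)) (by simp))
    rw [Real.dist_eq, sub_zero, abs_of_nonneg hpos]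
    refine lt_of_le_of_lt (koetheNorm_le fun x hx => ?_) (half_lt_self hε)
    exact (mem_mulDual_ellOne.1 hmem x).tsum_le_of_sum_range_le (hN n hn x hx)

/-- The Köthe dual of a saturated space is saturated. -/
theorem saturated_koetheDual (hX : Saturated X.carrier) : Saturated (X.koetheDual hX).carrier := by
  rintro A ⟨n, hn⟩
  refine ⟨Pi.single n 1, mem_mulDual_ellOne.2 fun x => ?_, fun h => ?_⟩
  · refine summable_of_ne_finset_zero (s := {n}) fun k hk => ?_
    have : k ≠ n := by simpa using hk
    simp [this]
  · have := congrFun h n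
    simp [hn] at this

/-- The Köthe bidual `X''`. -/
noncomputable def koetheBidual (X : BanachSeqSpace) (hX : Saturated X.carrier) : BanachSeqSpace :=
  (X.koetheDual hX).koetheDual (saturated_koetheDual hX)

end koethe

/-- `s = ∑ₙ ‖fₙ‖ ‖gₙ‖ < ∞` for some `fₙ ∈ X`, `gₙ ∈ Y` with `|v| ≤ ∑ₙ |fₙ gₙ|` pointwise.  (The
pointwise sums are taken in `[0, ∞]`.) -/
def PiBound (X Y : BanachSeqSpace) (v : ℕ → ℝ) (s : ℝ) : Prop :=
  ∃ (f : ℕ → X) (g : ℕ → Y), HasSum (fun n => ‖f n‖ * ‖g n‖) s ∧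
    ∀ k, ENNReal.ofReal |v k| ≤ ∑' n, ENNReal.ofReal |(f n).seq k * (g n).seq k|

/-- The norm of the product space `X π Y = {v : ∃ s, PiBound X Y v s}`. -/
noncomputable def piNorm (X Y : BanachSeqSpace) (v : ℕ → ℝ) : ℝ :=
  sInf {s | PiBound X Y v s}

/-- The matrix `(T(eʲ)ᵢ)` of an operator `T`. -/
noncomputable def opMatrix {X Y : BanachSeqSpace} (hX : Saturated X.carrier) (T : X →L[ℝ] Y) (i j : ℕ) : ℝ :=
  (T (X.unit hX j)).seq i

/-- `T : X₁ → Y₁` factors strongly through `S : X₂ → Y₂` and `M_h`: there is `g ∈ Y₂^{Y₁''}` with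
`T = M_g ∘ S ∘ M_h` as operators into `Y₁''` (an equality of sequences for each `x ∈ X₁`). -/
def FactorsStrongly {X₁ X₂ Y₁ Y₂ : BanachSeqSpace} (hY₁ : Saturated Y₁.carrier)
    (T : X₁ →L[ℝ] Y₁) (S : X₂ →L[ℝ] Y₂) {h : ℕ → ℝ}
    (hh : h ∈ mulDual X₁.carrier X₂.carrier) : Prop :=
  ∃ (g : ℕ → ℝ) (hg : g ∈ mulDual Y₂.carrier (Y₁.koetheBidual hY₁).carrier),
    ∀ x : X₁, (T x).seq = (mulOp hg (S (mulOp hh x))).seq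

end BanachSeqSpace

namespace BanachSeqSpace

/-! Put `c i j = h j * b i j`. Coordinates are continuous and the unit vectors are a basis of `X₁`,
so a strong factorization is the same as a matrix identity `a i j = g i * c i j` with `g` in
`Y₂^{Y₁''}`. This is (b) after dividing by `b i j`.

If such a `g` exists, Hölder's inequality gives `∑ |g i * f i * z i| ≤ ‖M_g‖ ‖f‖ ‖z‖` for `f ∈ Y₂`,
`z ∈ Y₁'`. Summing over a representation in `Y₂ π Y₁'` shows that `v ↦ ∑ g i * v i` is bounded on
finite sequences, which is (c) (`exists_sum_mul_le_piNorm`).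

Conversely, (c) says that a combination of a row of `c` that vanishes also vanishes on the row of
`a`, so the rows are proportional (`exists_eq_mul_of_sum_eq_zero`). That the factors form a
multiplier follows by testing (c) with one entry per row, chosen so that the right side sees at most
`|x z|` and the left side is `∑ |g i * x i * z i|` (`exists_mem_mulDual_of_le_piNorm`).

Condition (d) is the same matrix identity with `g` bounded (`exists_forall_sum_le_iff`), so its
relation to (a) is the relation of `ℓ^∞` to `Y₂^{Y₁''}`. -/

theorem continuous_mulOp {X Y : BanachSeqSpace} {h : ℕ → ℝ}
    (hh : h ∈ mulDual X.carrier Y.carrier) : Continuous (mulOp hh) := by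
  -- Closed graph: limits in both spaces are determined coordinatewise.
  refine LinearMap.continuous_of_seq_closed_graph _ fun u x y hu hv => ?_
  refine seq_injective (funext fun k => ?_)
  obtain ⟨φ, hφ⟩ := X.exists_coord k
  obtain ⟨ψ, hψ⟩ := Y.exists_coord k
  have h1 : Tendsto (fun n => φ (u n) * h k) atTop (𝓝 (φ x * h k)) :=
    ((φ.continuous.tendsto x).comp hu).mul_const _
  have h2 : Tendsto (fun n => ψ (mulOp hh (u n))) atTop (𝓝 (ψ y)) :=
    (ψ.continuous.tendsto y).comp hv
  have h3 : (fun n => ψ (mulOp hh (u n))) = fun n => φ (u n) * h k := by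
    funext n
    rw [hψ, hφ]
    rfl
  rw [h3] at h2
  have h4 := tendsto_nhds_unique h2 h1
  rw [hψ, hφ] at h4
  exact h4

theorem exists_norm_mulOp_le {X Y : BanachSeqSpace} {h : ℕ → ℝ}
    (hh : h ∈ mulDual X.carrier Y.carrier) :
    ∃ C > 0, ∀ x : X, ‖mulOp hh x‖ ≤ C * ‖x‖ :=
  (⟨mulOp hh, continuous_mulOp hh⟩ : X →L[ℝ] Y).bound

/-- Two continuous operators that agree on a Schauder basis of unit vectors are equal. -/
theorem HasUnitBasis.clm_ext {X : BanachSeqSpace} {hX : Saturated X.carrier}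
    (bX : X.HasUnitBasis hX) {φ ψ : X →L[ℝ] ℝ} (h : ∀ j, φ (X.unit hX j) = ψ (X.unit hX j)) :
    φ = ψ := by
  obtain ⟨b, hb⟩ := bX
  ext x
  have hx := b.expansion x
  refine (hx.mapL φ).unique ?_
  convert hx.mapL ψ using 2 with n
  simp [hb, h]

/-- The Hölder inequality for a Köthe dual. -/
theorem sum_abs_mul_le {X : BanachSeqSpace} (hX : Saturated X.carrier) (x : X)
    (y : X.koetheDual hX) (n : ℕ) :
    ∑ k ∈ Finset.range n, |x.seq k * y.seq k| ≤ ‖x‖ * ‖y‖ := by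
  by_cases hx : x = 0
  · subst hx
    have h0 : ∀ k, (0 : X).seq k = 0 := fun _ => rfl
    simp [h0]
  have hp : 0 < ‖x‖ := norm_pos_iff.2 hx
  have hy : y.seq ∈ mulDual X.carrier ellOne := seq_mem y
  have h1 : ∑' k, |(‖x‖⁻¹ • x).seq k * y.seq k| ≤ ‖y‖ :=
    le_koetheNorm hy (by rw [norm_smul, norm_inv, norm_norm, inv_mul_cancel₀ hp.ne'])
  have h2 := ((mem_mulDual_ellOne.1 hy (‖x‖⁻¹ • x)).sum_le_tsum (Finset.range n)
    (fun _ _ => abs_nonneg _)).trans h1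
  have h3 : ∀ k, |(‖x‖⁻¹ • x).seq k * y.seq k| = ‖x‖⁻¹ * |x.seq k * y.seq k| := fun k => by
    rw [seq_smul, Pi.smul_apply, smul_eq_mul, mul_assoc, abs_mul, abs_of_pos (inv_pos.2 hp)]
  simp only [h3, ← Finset.mul_sum] at h2
  rwa [inv_mul_le_iff₀ hp] at h2

/-! ### The product norm on finite sequences -/

section piNorm

variable {X Y : BanachSeqSpace}

theorem PiBound.nonneg {v : ℕ → ℝ} {s : ℝ} (h : PiBound X Y v s) : 0 ≤ s := by
  obtain ⟨f, g, hs, -⟩ := h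
  exact hs.nonneg fun n => mul_nonneg (norm_nonneg _) (norm_nonneg _)

theorem PiBound.piNorm_le {v : ℕ → ℝ} {s : ℝ} (h : PiBound X Y v s) : piNorm X Y v ≤ s :=
  csInf_le ⟨0, fun _ ht => PiBound.nonneg ht⟩ h

theorem piBound_of_abs_le {v : ℕ → ℝ} (x : X) (y : Y) (h : ∀ k, |v k| ≤ |x.seq k * y.seq k|) :
    PiBound X Y v (‖x‖ * ‖y‖) := by
  refine ⟨fun n => if n = 0 then x else 0, fun n => if n = 0 then y else 0, ?_, fun k => ?_⟩
  · convert hasSum_ite_eq 0 (‖x‖ * ‖y‖) using 2 with n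
    by_cases hn : n = 0 <;> simp [hn]
  · refine (ENNReal.ofReal_le_ofReal (h k)).trans ?_
    refine le_trans ?_ (ENNReal.le_tsum 0)
    simp

/-- Finitely supported sequences lie in the product of two saturated spaces. -/
theorem exists_piBound_of_forall_ge (hX : Saturated X.carrier) (hY : Saturated Y.carrier)
    {v : ℕ → ℝ} {n : ℕ} (hv : ∀ k, n ≤ k → v k = 0) : ∃ s, PiBound X Y v s := by
  refine ⟨_, fun k => v k • X.unit hX k, fun k => Y.unit hY k,
    (summable_of_ne_finset_zero (s := Finset.range n) fun k hk => ?_).hasSum, fun k => ?_⟩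
  · simp [hv k (by simpa using hk)]
  · refine le_trans ?_ (ENNReal.le_tsum k)
    rw [seq_smul]
    simp [unit, seq_ofSeq]

end piNorm

/-- A sequence `g ∈ X^{Y''}` defines a bounded functional on the finite sequences of `X π Y'`. -/
theorem exists_sum_mul_le_piNorm {X Y : BanachSeqSpace} (hX : Saturated X.carrier)
    (hY : Saturated Y.carrier) {g : ℕ → ℝ}
    (hg : g ∈ mulDual X.carrier (Y.koetheBidual hY).carrier) :
    ∃ C > 0, ∀ (n : ℕ) (v : ℕ → ℝ), (∀ k, n ≤ k → v k = 0) →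
      ∑ i ∈ Finset.range n, g i * v i ≤ C * piNorm X (Y.koetheDual hY) v := by
  obtain ⟨C, hC, hb⟩ := exists_norm_mulOp_le hg
  refine ⟨C, hC, fun n v hv => ?_⟩
  rw [← div_le_iff₀' hC]
  -- Finite support matters: without a representation of `v` the infimum would be the default value
  -- `0`.
  refine le_csInf (exists_piBound_of_forall_ge hX (saturated_koetheDual hY) hv) ?_
  rintro s hs
  have hs0 := hs.nonneg
  obtain ⟨f, z, hsum, hle⟩ := hs
  rw [div_le_iff₀' hC]
  -- Hölder's inequality between `Y'` and `Y''`, applied to `z N` and `M_g (f N)`.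
  have hterm : ∀ N, ∑ i ∈ Finset.range n, |g i| * |(f N).seq i * (z N).seq i|
      ≤ C * (‖f N‖ * ‖z N‖) := fun N => by
    have h1 := sum_abs_mul_le (saturated_koetheDual hY) (z N) (mulOp hg (f N)) n
    refine le_trans (le_of_eq (Finset.sum_congr rfl fun i _ => ?_)) (h1.trans ?_)
    · change _ = |(z N).seq i * ((f N).seq i * g i)|
      rw [← abs_mul]
      ring_nf
    · calc _ ≤ ‖z N‖ * (C * ‖f N‖) := mul_le_mul_of_nonneg_left (hb _) (norm_nonneg _)
        _ = _ := by ring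
  refine (Finset.sum_le_sum fun i _ => (le_abs_self (g i * v i)).trans (abs_mul _ _).le).trans ?_
  -- In `[0, ∞]` the domination of `v` can be used and the two sums exchanged freely.
  refine (ENNReal.ofReal_le_ofReal_iff (mul_nonneg hC.le hs0)).1 ?_
  rw [ENNReal.ofReal_sum_of_nonneg fun i _ => mul_nonneg (abs_nonneg _) (abs_nonneg _)]
  calc ∑ i ∈ Finset.range n, ENNReal.ofReal (|g i| * |v i|)
      ≤ ∑ i ∈ Finset.range n,
          ∑' N, ENNReal.ofReal (|g i| * |(f N).seq i * (z N).seq i|) := by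
        refine Finset.sum_le_sum fun i _ => ?_
        simp only [ENNReal.ofReal_mul (abs_nonneg (g i)), ENNReal.tsum_mul_left]
        exact mul_le_mul_right (hle i) _
    _ = ∑' N, ∑ i ∈ Finset.range n, ENNReal.ofReal (|g i| * |(f N).seq i * (z N).seq i|) :=
        (Summable.tsum_finsetSum fun _ _ => ENNReal.summable).symm
    _ ≤ ∑' N, ENNReal.ofReal (C * (‖f N‖ * ‖z N‖)) := by
        refine ENNReal.tsum_le_tsum fun N => ?_
        rw [← ENNReal.ofReal_sum_of_nonneg fun i _ => mul_nonneg (abs_nonneg _) (abs_nonneg _)]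
        exact ENNReal.ofReal_le_ofReal (hterm N)
    _ = ENNReal.ofReal (C * s) := by
        rw [← (hsum.mul_left C).tsum_eq, ENNReal.ofReal_tsum_of_nonneg
          (fun N => mul_nonneg hC.le (mul_nonneg (norm_nonneg _) (norm_nonneg _)))
          (hsum.mul_left C).summable]

/-! ### From inequalities to a multiplier -/

/-- A sequence `a` is a multiple of `c` if every finite combination that annihilates `c`
annihilates `a`. -/
theorem exists_eq_mul_of_sum_eq_zero {a c : ℕ → ℝ}
    (H : ∀ (m : ℕ) (r : ℕ → ℝ), (∀ j, |r j| ≤ 1) → ∑ j ∈ Finset.range m, r j * c j = 0 →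
      ∑ j ∈ Finset.range m, r j * a j ≤ 0) :
    ∃ g : ℝ, (∀ j, a j = g * c j) ∧ ((∀ j, c j = 0) → g = 0) := by
  have hsum : ∀ (d : ℕ → ℝ) (j m : ℕ) (t : ℝ), j < m →
      ∑ i ∈ Finset.range m, (Pi.single j t : ℕ → ℝ) i * d i = t * d j := fun d j m t hj => by
    rw [Finset.sum_eq_single_of_mem j (Finset.mem_range.2 hj) fun i _ hi => by simp [hi]]
    simp
  by_cases h0 : ∀ j, c j = 0
  · refine ⟨0, fun j => ?_, fun _ => rfl⟩
    have key : ∀ t : ℝ, |t| ≤ 1 → t * a j ≤ 0 := fun t ht => by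
      rw [← hsum a j (j + 1) t j.lt_succ_self]
      refine H _ _ (fun i => ?_) (by simp [h0])
      by_cases hi : i = j
      · subst hi; simpa using ht
      · simp [hi]
    have h1 := key 1 (by simp)
    have h2 := key (-1) (by simp)
    linarith
  · push Not at h0
    obtain ⟨k, hk⟩ := h0
    -- The coefficients `c k` at `j` and `-c j` at `k` annihilate `c`. Exchanging `j` and `k` later
    -- turns the inequality into an equality.
    have key : ∀ j k, c k * a j ≤ c j * a k := fun j k => by
      -- The factor `t` brings the coefficients into `[-1, 1]`, even when `j = k`.
      set t := (1 + |c j| + |c k|)⁻¹ with ht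
      have hD : 0 < 1 + |c j| + |c k| := by positivity
      have htp : 0 < t := inv_pos.2 hD
      have hs : ∀ d : ℕ → ℝ, ∑ i ∈ Finset.range (j + k + 1),
          ((Pi.single j (t * c k) : ℕ → ℝ) i - (Pi.single k (t * c j) : ℕ → ℝ) i) * d i
            = t * (c k * d j - c j * d k) := fun d => by
        simp only [sub_mul, Finset.sum_sub_distrib]
        rw [hsum _ _ _ _ (by omega), hsum _ _ _ _ (by omega)]
        ring
      have h1 := H (j + k + 1)
        (fun i => (Pi.single j (t * c k) : ℕ → ℝ) i - (Pi.single k (t * c j) : ℕ → ℝ) i)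
        (fun i => by
          have hle : ∀ (l : ℕ) (u : ℝ), |(Pi.single l (t * u) : ℕ → ℝ) i| ≤ t * |u| := by
            intro l u
            by_cases hi : i = l
            · subst hi; simp [abs_mul, abs_of_pos htp]
            · simp only [ne_eq, hi, not_false_eq_true, Pi.single_eq_of_ne, abs_zero]
              positivity
          refine (abs_sub _ _).trans ((add_le_add (hle _ _) (hle _ _)).trans ?_)
          rw [← mul_add, ht, inv_mul_le_iff₀ hD]
          linarith)
        (by rw [hs]; ring)
      rw [hs] at h1
      have h2 := nonpos_of_mul_nonpos_right h1 htp
      linarith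
    refine ⟨a k / c k, fun j => ?_, fun h => absurd (h k) hk⟩
    have h1 := le_antisymm (key j k) (key k j)
    field_simp
    linarith

/-- If `c ↦ a` is bounded on finite sums of rows with respect to the norm of `X π Y'`, then the rows
of `a` are the rows of `c` multiplied by a sequence in `X^{Y''}`. -/
theorem exists_mem_mulDual_of_le_piNorm {X Y : BanachSeqSpace} (hY : Saturated Y.carrier)
    {a c : ℕ → ℕ → ℝ} {C : ℝ} (hC : 0 < C)
    (H : ∀ (n m : ℕ) (r : ℕ → ℕ → ℝ), (∀ i j, |r i j| ≤ 1) →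
      ∑ i ∈ Finset.range n, ∑ j ∈ Finset.range m, r i j * a i j ≤
        C * piNorm X (Y.koetheDual hY) (∑ i ∈ Finset.range n,
          (∑ j ∈ Finset.range m, r i j * c i j) • (Pi.single i 1 : ℕ → ℝ))) :
    ∃ g ∈ mulDual X.carrier (Y.koetheBidual hY).carrier, ∀ i j, a i j = g i * c i j := by
  -- A zero row of `c` leaves the factor undetermined; it is set to `0` so that it cannot spoil
  -- membership in the multiplier space.
  have hrow : ∀ i, ∃ g : ℝ, (∀ j, a i j = g * c i j) ∧ ((∀ j, c i j = 0) → g = 0) := fun i => by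
    refine exists_eq_mul_of_sum_eq_zero fun m r hr h0 => ?_
    have h1 := H (i + 1) m (fun k j => if k = i then r j else 0) fun k j => by
      split_ifs
      · exact hr j
      · simp
    have h2 : ∑ k ∈ Finset.range (i + 1),
        (∑ j ∈ Finset.range m, (if k = i then r j else 0) * c k j) •
          (Pi.single k 1 : ℕ → ℝ) = 0 := by
      refine Finset.sum_eq_zero fun k _ => ?_
      by_cases hk : k = i
      · subst hk; simp [h0]
      · simp [hk]
    have h3 : ∑ k ∈ Finset.range (i + 1), ∑ j ∈ Finset.range m, (if k = i then r j else 0) * a k j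
        = ∑ j ∈ Finset.range m, r j * a i j := by
      rw [Finset.sum_eq_single_of_mem i (by simp) fun k _ hk => by simp [hk]]
      simp
    rw [h2, h3] at h1
    have h4 : piNorm X (Y.koetheDual hY) 0 ≤ ‖(0 : X)‖ * ‖(0 : Y.koetheDual hY)‖ :=
      (piBound_of_abs_le 0 0 fun k => by
        rw [Pi.zero_apply, abs_zero]
        exact abs_nonneg _).piNorm_le
    rw [norm_zero, zero_mul] at h4
    exact h1.trans (mul_nonpos_of_nonneg_of_nonpos hC.le h4)
  choose g hg hg0 using hrow
  refine ⟨g, fun x hx => mem_mulDual_ellOne.2 fun z => ?_, hg⟩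
  -- Each row gets a column `σ i` with a nonzero entry, unless the row is zero.
  have hsel : ∀ i, ∃ j, c i j = 0 → g i = 0 := fun i => by
    by_cases h : ∀ j, c i j = 0
    · exact ⟨0, fun _ => hg0 i h⟩
    · push Not at h
      obtain ⟨j, hj⟩ := h
      exact ⟨j, fun h => absurd h hj⟩
  choose σ hσ using hsel
  refine summable_of_sum_range_le (c := C * (‖X.ofSeq x hx‖ * ‖z‖)) (fun _ => abs_nonneg _)
    fun n => ?_
  obtain ⟨m, hm⟩ : ∃ m, ∀ i ∈ Finset.range n, σ i < m :=
    ⟨(Finset.range n).sup σ + 1, fun i hi => Nat.lt_succ_of_le (Finset.le_sup hi)⟩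
  -- The target vector: `w i * g i = |g i * x i * z i|`, while `|w| ≤ |x z|`.
  set w : ℕ → ℝ := fun i => SignType.sign (g i) * |x i * z.seq i| with hw
  -- The coefficient at `(i, σ i)` that produces `w i`. If `c i (σ i) = 0` the quotient is `0`,
  -- which is harmless because then `g i = 0`.
  set q : ℕ → ℝ := fun i => w i / c i (σ i) with hq
  -- Dividing by `D` makes all coefficients at most `1` in modulus; `D` cancels at the end by
  -- homogeneity.
  set D : ℝ := 1 + ∑ i ∈ Finset.range n, |q i| with hD
  have hDp : 0 < D := add_pos_of_pos_of_nonneg one_pos (Finset.sum_nonneg fun _ _ => abs_nonneg _)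
  have htp : 0 < D⁻¹ := inv_pos.2 hDp
  have hwle : ∀ i, |w i| ≤ |x i * z.seq i| := fun i => by
    have h1 : |((SignType.sign (g i) : SignType) : ℝ)| ≤ 1 := by
      rcases lt_trichotomy (g i) 0 with h | h | h <;> simp [h]
    rw [hw, abs_mul, abs_abs]
    exact mul_le_of_le_one_left (abs_nonneg _) h1
  have h1 := H n m
    (fun i j => if i ∈ Finset.range n ∧ j = σ i then D⁻¹ * q i else 0) fun i j => by
      split_ifs with h
      · rw [abs_mul, abs_of_pos htp, inv_mul_le_iff₀ hDp, mul_one, hD]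
        have := Finset.single_le_sum (f := fun i => |q i|) (fun _ _ => abs_nonneg _) h.1
        linarith
      · simp
  have hsum : ∀ d : ℕ → ℕ → ℝ, ∀ i ∈ Finset.range n, ∑ j ∈ Finset.range m,
      (if i ∈ Finset.range n ∧ j = σ i then D⁻¹ * q i else 0) * d i j
        = D⁻¹ * (q i * d i (σ i)) := fun d i hi => by
    rw [Finset.sum_eq_single_of_mem (σ i) (Finset.mem_range.2 (hm i hi))
      fun j _ hj => by simp [hj]]
    rw [if_pos ⟨hi, rfl⟩, mul_assoc]
  rw [Finset.sum_congr rfl (hsum a), ← Finset.mul_sum] at h1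
  -- A single product, `D⁻¹ x` times `z`, dominates the test vector.
  have hbd : PiBound X (Y.koetheDual hY) (∑ i ∈ Finset.range n,
      (∑ j ∈ Finset.range m, (if i ∈ Finset.range n ∧ j = σ i then D⁻¹ * q i else 0) * c i j) •
        (Pi.single i 1 : ℕ → ℝ)) (‖D⁻¹ • X.ofSeq x hx‖ * ‖z‖) := by
    refine piBound_of_abs_le _ _ fun k => ?_
    have hpos : |(D⁻¹ • X.ofSeq x hx).seq k * z.seq k| = D⁻¹ * |x k * z.seq k| := by
      rw [seq_smul, seq_ofSeq, Pi.smul_apply, smul_eq_mul, mul_assoc, abs_mul, abs_of_pos htp]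
    rw [hpos, Finset.sum_apply]
    by_cases hk : k ∈ Finset.range n
    · rw [Finset.sum_eq_single_of_mem k hk fun i _ hi => by simp [Ne.symm hi],
        Pi.smul_apply, smul_eq_mul, hsum c k hk, Pi.single_eq_same, mul_one, abs_mul,
        abs_of_pos htp]
      refine mul_le_mul_of_nonneg_left (le_trans ?_ (hwle k)) htp.le
      by_cases hc : c k (σ k) = 0
      · simp [hc]
      · rw [hq]
        simp only [div_mul_cancel₀ _ hc, le_refl]
    · rw [Finset.sum_eq_zero fun i hi => ?_, abs_zero]
      · positivity
      · have : k ≠ i := fun h => hk (h ▸ hi)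
        simp [this]
  have h2 := h1.trans (mul_le_mul_of_nonneg_left hbd.piNorm_le hC.le)
  rw [norm_smul, Real.norm_eq_abs, abs_of_pos htp] at h2
  have h3 : ∀ i ∈ Finset.range n, q i * a i (σ i) = |z.seq i * (x * g) i| := fun i _ => by
    rw [hg i]
    have habs : (SignType.sign (g i) : ℝ) * g i = |g i| := sign_mul_self _
    have hr : |z.seq i * (x * g) i| = |x i * z.seq i| * |g i| := by
      rw [← abs_mul, Pi.mul_apply]; ring_nf
    rw [hr]
    by_cases hc : c i (σ i) = 0
    · simp [hc, hσ i hc]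
    · rw [hq, hw, ← habs]
      field_simp
  rw [Finset.sum_congr rfl h3] at h2
  have h4 : D⁻¹ * ∑ i ∈ Finset.range n, |z.seq i * (x * g) i|
      ≤ D⁻¹ * (C * (‖X.ofSeq x hx‖ * ‖z‖)) := by
    calc _ ≤ _ := h2
      _ = _ := by ring
  exact le_of_mul_le_mul_left h4 htp

/-! ### Matrix form of the factorization and of (d) -/

/-- A strong factorization is a factorization of the matrices. -/
theorem factorsStrongly_iff {X₁ X₂ Y₁ Y₂ : BanachSeqSpace} {hX₁ : Saturated X₁.carrier}
    {hX₂ : Saturated X₂.carrier} (hY₁ : Saturated Y₁.carrier) (bX₁ : X₁.HasUnitBasis hX₁)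
    (T : X₁ →L[ℝ] Y₁) (S : X₂ →L[ℝ] Y₂) {h : ℕ → ℝ} (hh : h ∈ mulDual X₁.carrier X₂.carrier) :
    FactorsStrongly hY₁ T S hh ↔ ∃ g ∈ mulDual Y₂.carrier (Y₁.koetheBidual hY₁).carrier,
      ∀ i j, opMatrix hX₁ T i j = g i * (h j * opMatrix hX₂ S i j) := by
  have hunit : ∀ j, mulOp hh (X₁.unit hX₁ j) = h j • X₂.unit hX₂ j := fun j => by
    refine seq_injective (funext fun k => ?_)
    change (Pi.single j 1 : ℕ → ℝ) k * h k = h j * (Pi.single j 1 : ℕ → ℝ) k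
    by_cases hk : k = j
    · subst hk; ring
    · simp [hk]
  have hS : ∀ i j, (S (mulOp hh (X₁.unit hX₁ j))).seq i = h j * opMatrix hX₂ S i j := fun i j => by
    rw [hunit, map_smul]
    rfl
  constructor
  · rintro ⟨g, hg, H⟩
    refine ⟨g, hg, fun i j => ?_⟩
    rw [← hS, mul_comm]
    exact congrFun (H (X₁.unit hX₁ j)) i
  · rintro ⟨g, hg, H⟩
    refine ⟨g, hg, fun x => funext fun i => ?_⟩
    obtain ⟨φ, hφ⟩ := Y₁.exists_coord i
    obtain ⟨ψ, hψ⟩ := Y₂.exists_coord i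
    -- In a fixed coordinate `M_g` is only the scalar `g i`, so scalar functionals on `X₁` are
    -- compared on the basis.
    have key : φ ∘L T = g i • (ψ ∘L S ∘L ⟨mulOp hh, continuous_mulOp hh⟩) :=
      bX₁.clm_ext fun j => by
        change φ (T (X₁.unit hX₁ j)) = g i * ψ (S (mulOp hh (X₁.unit hX₁ j)))
        rw [hφ, hψ, hS]
        exact H i j
    have h1 : φ (T x) = g i * ψ (S (mulOp hh x)) := DFunLike.congr_fun key x
    rw [hφ, hψ, mul_comm] at h1
    exact h1

/-- Row-wise domination of `a` by `c` means that the rows of `a` are the rows of `c` multiplied by a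
bounded sequence. -/
theorem exists_forall_sum_le_iff {a c : ℕ → ℕ → ℝ} :
    (∃ C > 0, ∀ (n m : ℕ) (r : ℕ → ℝ), (∀ j, |r j| ≤ 1) →
      ∑ j ∈ Finset.range m, r j * a n j ≤ C * |∑ j ∈ Finset.range m, r j * c n j|) ↔
    ∃ g ∈ ellInfty, ∀ i j, a i j = g i * c i j := by
  constructor
  · rintro ⟨C, hC, H⟩
    have hrow : ∀ i, ∃ g : ℝ, (∀ j, a i j = g * c i j) ∧ ((∀ j, c i j = 0) → g = 0) := fun i =>
      exists_eq_mul_of_sum_eq_zero fun m r hr h0 => by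
        have h1 := H i m r hr
        rwa [h0, abs_zero, mul_zero] at h1
    choose g hg hg0 using hrow
    refine ⟨g, ⟨C, fun i => ?_⟩, hg⟩
    by_cases h0 : ∀ j, c i j = 0
    · rw [hg0 i h0, abs_zero]
      exact hC.le
    push Not at h0
    obtain ⟨j, hj⟩ := h0
    -- The values `t = 1` and `t = -1` give `|a i j| ≤ C * |c i j|`, hence `|g i| ≤ C`.
    have key : ∀ t : ℝ, |t| ≤ 1 → t * a i j ≤ C * |t * c i j| := fun t ht => by
      have h1 := H i (j + 1) (Pi.single j t) fun k => by
        by_cases hk : k = j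
        · subst hk; simpa using ht
        · simp [hk]
      rw [Finset.sum_eq_single_of_mem j (by simp) fun k _ hk => by simp [hk],
        Finset.sum_eq_single_of_mem j (by simp) fun k _ hk => by simp [hk]] at h1
      simpa using h1
    have h1 := key 1 (by simp)
    have h2 := key (-1) (by simp)
    rw [one_mul, one_mul] at h1
    rw [neg_one_mul, neg_one_mul, abs_neg] at h2
    have h3 : |a i j| ≤ C * |c i j| := abs_le'.2 ⟨h1, h2⟩
    rw [hg i j, abs_mul] at h3
    exact le_of_mul_le_mul_right h3 (abs_pos.2 hj)
  · rintro ⟨g, ⟨C, hC⟩, hg⟩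
    refine ⟨|C| + 1, by positivity, fun n m r _ => ?_⟩
    have h1 : ∑ j ∈ Finset.range m, r j * a n j = g n * ∑ j ∈ Finset.range m, r j * c n j := by
      rw [Finset.mul_sum]
      exact Finset.sum_congr rfl fun j _ => by rw [hg]; ring
    rw [h1]
    refine (le_abs_self _).trans ?_
    rw [abs_mul]
    refine mul_le_mul_of_nonneg_right ((hC n).trans ?_) (abs_nonneg _)
    linarith [le_abs_self C]

/-- Bounded sequences are multipliers of `X` into `Y` if `X ⊆ Y`. -/
theorem ellInfty_le_mulDual {X Y : BanachSeqSpace} (hXY : X.carrier ≤ Y.carrier) :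
    ellInfty ≤ mulDual X.carrier Y.carrier := by
  rintro g ⟨C, hC⟩ f hf
  refine (norm_le_of_abs_le (g := Y.ofSeq (C • f) (Y.carrier.smul_mem C (hXY hf))) fun k => ?_).1
  rw [seq_ofSeq, Pi.mul_apply, Pi.smul_apply, smul_eq_mul, abs_mul, abs_mul, mul_comm]
  exact mul_le_mul_of_nonneg_right ((hC k).trans (le_abs_self C)) (abs_nonneg _)

end BanachSeqSpace

/-! ### The equivalences -/

open BanachSeqSpace in
theorem proposition5p2
    (X₁ X₂ Y₁ Y₂ : BanachSeqSpace)
    (hX₁ : Saturated X₁.carrier) (hX₂ : Saturated X₂.carrier)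
    (hY₁ : Saturated Y₁.carrier) (hY₂ : Saturated Y₂.carrier)
    (bX₁ : X₁.HasUnitBasis hX₁) (bX₂ : X₂.HasUnitBasis hX₂)
    (bY₁ : Y₁.HasUnitBasis hY₁) (bY₂ : Y₂.HasUnitBasis hY₂)
    (bY₁' : (Y₁.koetheDual hY₁).HasUnitBasis (saturated_koetheDual hY₁))
    (T : X₁ →L[ℝ] Y₁) (S : X₂ →L[ℝ] Y₂) (hT : T ≠ 0) (hS : S ≠ 0)
    (a b : ℕ → ℕ → ℝ) (ha : a = opMatrix hX₁ T) (hb : b = opMatrix hX₂ S)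
    (hsat : Saturated (mulDual Y₂.carrier (Y₁.koetheBidual hY₁).carrier))
    (hoc : Y₂.SigmaOrderContinuous ∨ (Y₁.koetheDual hY₁).SigmaOrderContinuous)
    (h : ℕ → ℝ) (hh : h ∈ mulDual X₁.carrier X₂.carrier) :
    List.TFAE [
      FactorsStrongly hY₁ T S hh,
      ∃ g ∈ mulDual Y₂.carrier (Y₁.koetheBidual hY₁).carrier, ∀ i j,
        (b i j ≠ 0 → a i j / b i j = g i * h j) ∧ (b i j = 0 → a i j = 0),
      ∃ C > 0, ∀ (n m : ℕ) (r : ℕ → ℕ → ℝ), (∀ i j, |r i j| ≤ 1) →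
        ∑ i ∈ Finset.range n, ∑ j ∈ Finset.range m, r i j * a i j ≤
          C * piNorm Y₂ (Y₁.koetheDual hY₁)
            (∑ i ∈ Finset.range n,
              (∑ j ∈ Finset.range m, h j * r i j * b i j) • (Pi.single i 1 : ℕ → ℝ))] ∧
    (Y₂.carrier ≤ (Y₁.koetheBidual hY₁).carrier →
      (∃ C > 0, ∀ (n m : ℕ) (r : ℕ → ℝ), (∀ j, |r j| ≤ 1) →
        ∑ j ∈ Finset.range m, r j * a n j ≤ C * |∑ j ∈ Finset.range m, h j * r j * b n j|) →
      FactorsStrongly hY₁ T S hh) ∧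
    (ellInfty = mulDual Y₂.carrier (Y₁.koetheBidual hY₁).carrier →
      ((∃ C > 0, ∀ (n m : ℕ) (r : ℕ → ℝ), (∀ j, |r j| ≤ 1) →
        ∑ j ∈ Finset.range m, r j * a n j ≤ C * |∑ j ∈ Finset.range m, h j * r j * b n j|) ↔
      FactorsStrongly hY₁ T S hh)) := by
  subst ha hb
  -- Regrouping makes `h j * b i j` the entry of one matrix `c`, as the lemmas require.
  have hcomm : ∀ r s t : ℝ, s * r * t = r * (s * t) := fun r s t => by ring
  simp only [hcomm]
  have hab := factorsStrongly_iff (hX₂ := hX₂) hY₁ bX₁ T S hh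
  have hd := exists_forall_sum_le_iff (a := opMatrix hX₁ T)
    (c := fun i j => h j * opMatrix hX₂ S i j)
  refine ⟨?_, fun hle hC => ?_, fun heq => ?_⟩
  · tfae_have 1 ↔ 2 := by
      rw [hab]
      refine exists_congr fun g => and_congr_right fun _ => forall₂_congr fun i j => ?_
      by_cases hb : opMatrix hX₂ S i j = 0
      · simp [hb]
      · simp only [ne_eq, hb, not_false_eq_true, forall_const, IsEmpty.forall_iff, and_true]
        rw [div_eq_iff hb, mul_assoc]
    tfae_have 1 → 3 := by
      rw [hab]
      rintro ⟨g, hg, H⟩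
      obtain ⟨C, hC, hle⟩ := exists_sum_mul_le_piNorm hY₂ hY₁ hg
      refine ⟨C, hC, fun n m r _ => ?_⟩
      have hv : ∀ k, (∑ i ∈ Finset.range n, (∑ j ∈ Finset.range m,
          r i j * (h j * opMatrix hX₂ S i j)) • (Pi.single i 1 : ℕ → ℝ)) k
          = if k ∈ Finset.range n then
            ∑ j ∈ Finset.range m, r k j * (h j * opMatrix hX₂ S k j) else 0 := fun k => by
        simp [Finset.sum_apply, Pi.single_apply]
      refine le_trans (le_of_eq (Finset.sum_congr rfl fun i hi => ?_)) (hle n _ fun k hk => ?_)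
      · rw [hv, if_pos hi, Finset.mul_sum]
        exact Finset.sum_congr rfl fun j _ => by rw [H]; ring
      · rw [hv, if_neg (by simpa using hk)]
    tfae_have 3 → 1 := by
      rintro ⟨C, hC, H⟩
      exact hab.2 (exists_mem_mulDual_of_le_piNorm hY₁ hC H)
    tfae_finish
  · obtain ⟨g, hg, H⟩ := hd.1 hC
    exact hab.2 ⟨g, ellInfty_le_mulDual hle hg, H⟩
  · rw [hab, ← heq]
    exact hd
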